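/- Let $\Omega$ be a finite set, $P_0$ a probability distribution on $\Omega$ with $P_0(x)>0$ for all $x\in\Omega$, and $T$ a proposal kernel on $\Omega$, that is, $T(x,y)\in(0,1)$ for all $x,y\in\Omega$ and $\sum_{y\in\Omega}T(x,y)=1$ for all $x\in\Omega$ (so $|\Omega|\ge 2$). For $L:\Omega\to(0,\infty)$ let $P_L(x)=P_0(x)e^{-L(x)}/\sum_{y\in\Omega}P_0(y)e^{-L(y)}$, and let $\mathcal C_L$ be the Metropolis–Hastings chain with target $P_L$ and proposal $T$, that is, the Markov chain on $\Omega$ with transition matrix $$W_{x,y}=T(x,y)A(x,y)\ (x\neq y),\qquad W_{x,x}=1-\sum_{z\neq x}T(x,z)A(x,z),\qquad A(x,y)=\min\Bigl\{1,\frac{P_L(y)T(y,x)}{P_L(x)T(x,y)}\Bigr\}.$$ Its spectral gap is $\Delta=1-|\lambda_1|$, where $\lambda_1$ is the eigenvalue of $W$ with the second largest modulus (eigenvalues counted with multiplicity). Let $L,\tilde L:\Omega\to(0,\infty)$, $P=P_L$, $\tilde P=P_{\tilde L}$, let $\Delta$ be the spectral gap of $\mathcal C_L$ and $P_{\min}=\min_{x\in\Omega}P(x)$.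 Then $P$ and $\tilde P$ are the unique stationary distributions of $\mathcal C_L$ and $\mathcal C_{\tilde L}$, respectively, $0<\Delta\le1$, and $$\|\tilde P-P\|_{\rm TV}\le 8\left(\left\lceil\frac{\log(2\sqrt{P_{\min}})}{\log(1-\Delta)}\right\rceil+\frac1\Delta\right)\max_{x\in\Omega}|\tilde L(x)-L(x)|,$$ where $\|\tilde P-P\|_{\rm TV}=\max_{A\subseteq\Omega}|\tilde P(A)-P(A)|$, and the quotient of logarithms is read as $0$ if $\Delta=1$. -/

import Mathlib

noncomputable section

namespace MetropolisHastings

variable {Ω : Type*} [Fintype Ω]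

/-- The probability distribution proportional to `P₀ * exp (-L)`. -/
def target (P₀ L : Ω → ℝ) (x : Ω) : ℝ :=
  P₀ x * Real.exp (-L x) / ∑ y, P₀ y * Real.exp (-L y)

/-- The acceptance ratio for the target distribution `P` and the proposal `T`. -/
def accept (P : Ω → ℝ) (T : Matrix Ω Ω ℝ) (x y : Ω) : ℝ :=
  min 1 (P y * T y x / (P x * T x y))

/-- The Metropolis-Hastings transition matrix for the target distribution `P` and the proposal
`T`; the entry `(x, y)` is the probability of a transition from `x` to `y`. -/
def transition [DecidableEq Ω] (P : Ω → ℝ) (T : Matrix Ω Ω ℝ) : Matrix Ω Ω ℝ := fun x y =>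
  if x = y then 1 - ∑ z ∈ Finset.univ.erase x, T x z * accept P T x z
  else T x y * accept P T x y

/-- `p` is a probability distribution that is invariant under the transition matrix `W`. -/
def IsStationary (W : Matrix Ω Ω ℝ) (p : Ω → ℝ) : Prop :=
  p ∈ stdSimplex ℝ Ω ∧ Matrix.vecMul p W = p

/-- The moduli of the complex eigenvalues of `W`, counted with algebraic multiplicity, in
decreasing order. -/
def eigenvalueModuli [DecidableEq Ω] (W : Matrix Ω Ω ℝ) : List ℝ :=
  ((W.map Complex.ofReal).charpoly.roots.map fun z => ‖z‖).sort (· ≥ ·)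

/-- One minus the second largest modulus of an eigenvalue of `W` (only used when there are at
least two states). -/
def spectralGap [DecidableEq Ω] (W : Matrix Ω Ω ℝ) : ℝ :=
  1 - (eigenvalueModuli W).getD 1 0

/-- The total variation distance: the maximum over all events `A` of `|p A - q A|`. -/
def tvDist (p q : Ω → ℝ) : ℝ :=
  ⨆ A : Finset Ω, |∑ x ∈ A, p x - ∑ x ∈ A, q x|

end MetropolisHastings

end

/-!
The two target distributions are comparable pointwise: if `|L' - L| ≤ ε`, then both the weights
`exp (-L x)` and the partition function change by a factor of at most `exp ε`, so that
`exp (-2 ε) * P' ≤ P` and the total variation distance is at most `2 ε`. This does not involve the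
chain at all, and it suffices because the bracket in the bound is always at least `1 / 2`: there
are at least two states, so `log (2 √Pmin) ≤ 1 / 2`, while `log (1 - Δ) ≤ -Δ`.

The spectral part rests on the strict maximum principle for a stochastic matrix with positive
entries: a function whose norm nowhere exceeds that of its average is constant. For reversible
chains it identifies the density of a stationary distribution with respect to `P` as a constant.
For complex eigenvectors it leaves `1` as the only eigenvalue of modulus at least `1`, with the
constants as eigenspace. That eigenvalue is algebraically simple because a function that increases
by the same amount `a` at every state when it is averaged forces `a = 0`.
-/

namespace MetropolisHastings

section OrderStatistics

theorem getD_sort_lt {α : Type*} [LinearOrder α] {m : Multiset α} {c d : α} {k : ℕ} (hd : d < c)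
    (hm : (m.filter (c ≤ ·)).card ≤ k) : (m.sort (· ≥ ·)).getD k d < c := by
  set l := m.sort (· ≥ ·)
  rcases le_or_gt l.length k with hk | hk
  · rwa [List.getD_eq_default _ _ hk]
  rw [List.getD_eq_getElem _ _ hk]
  by_contra! hc
  have htake : ∀ a ∈ l.take (k + 1), c ≤ a := by
    intro a ha
    obtain ⟨i, hi, rfl⟩ := List.mem_take_iff_getElem.1 ha
    have hik : i ≤ k := by omega
    exact hc.trans ((Multiset.pairwise_sort m (· ≥ ·)).rel_get_of_le (by simpa using hik))
  have hsub : (l.take (k + 1) : Multiset α) ≤ m.filter (c ≤ ·) :=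
    Multiset.le_filter.2 ⟨by
      rw [← Multiset.sort_eq m (· ≥ ·)]
      exact Multiset.coe_le.2 (List.take_sublist _ _).subperm, htake⟩
  have hcard := Multiset.card_le_card hsub
  rw [Multiset.coe_card, List.length_take] at hcard
  omega

end OrderStatistics

variable {Ω : Type*} [Fintype Ω]

section PositiveStochastic

variable {W : Matrix Ω Ω ℝ}

theorem eq_of_norm_le_norm_sum_smul {E : Type*} [NormedAddCommGroup E] [NormedSpace ℝ E]
    [StrictConvexSpace ℝ E] (hpos : ∀ x y, 0 < W x y) (hsum : ∀ x, ∑ y, W x y = 1) {u : Ω → E}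
    (hu : ∀ x, ‖u x‖ ≤ ‖∑ y, W x y • u y‖) (x y : Ω) : u x = u y := by
  have : Nonempty Ω := ⟨x⟩
  obtain ⟨m, hm⟩ := Finite.exists_max fun z => ‖u z‖
  by_contra hxy
  exact (norm_sum_lt_of_strictConvexSpace (fun z _ => (hpos m z).le) (hsum m) (Finset.mem_univ x)
    (Finset.mem_univ y) hxy (hpos m x).ne' (hpos m y).ne' fun z _ => hm z).not_ge (hu m)

theorem eq_zero_of_sum_smul_eq_add_const [Nonempty Ω] {E : Type*} [NormedAddCommGroup E]
    [InnerProductSpace ℝ E] (hnonneg : ∀ x y, 0 ≤ W x y) (hsum : ∀ x, ∑ y, W x y = 1)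
    {v : Ω → E} {a : E} (hv : ∀ x, ∑ y, W x y • v y = v x + a) : a = 0 := by
  obtain ⟨m, hm⟩ := Finite.exists_max fun x => inner ℝ a (v x)
  have haverage : inner ℝ a (v m) + inner ℝ a a ≤ inner ℝ a (v m) :=
    calc inner ℝ a (v m) + inner ℝ a a = ∑ y, W m y * inner ℝ a (v y) := by
          rw [← inner_add_right, ← hv m, inner_sum]
          simp only [real_inner_smul_right]
      _ ≤ ∑ y, W m y * inner ℝ a (v m) :=
          Finset.sum_le_sum fun y _ => mul_le_mul_of_nonneg_left (hm y) (hnonneg m y)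
      _ = inner ℝ a (v m) := by rw [← Finset.sum_mul, hsum, one_mul]
  exact inner_self_eq_zero.1 (le_antisymm (by linarith) real_inner_self_nonneg)

variable [DecidableEq Ω]

theorem toLin'_map_ofReal_apply (W : Matrix Ω Ω ℝ) (v : Ω → ℂ) (x : Ω) :
    (W.map Complex.ofReal).toLin' v x = ∑ y, W x y • v y := by
  simp [Matrix.mulVec, dotProduct]

theorem eq_of_toLin'_eq_smul (hpos : ∀ x y, 0 < W x y) (hsum : ∀ x, ∑ y, W x y = 1) {u : Ω → ℂ}
    {z : ℂ} (hz : 1 ≤ ‖z‖) (hu : (W.map Complex.ofReal).toLin' u = z • u) (x y : Ω) :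
    u x = u y := by
  refine eq_of_norm_le_norm_sum_smul hpos hsum (fun w => ?_) x y
  rw [← toLin'_map_ofReal_apply, hu, Pi.smul_apply, norm_smul]
  exact le_mul_of_one_le_left (norm_nonneg _) hz

theorem toLin'_map_ofReal_const (hsum : ∀ x, ∑ y, W x y = 1) (a : ℂ) :
    (W.map Complex.ofReal).toLin' (fun _ => a) = fun _ => a := by
  funext x
  rw [toLin'_map_ofReal_apply, ← Finset.sum_smul, hsum, one_smul]

theorem eq_one_of_hasEigenvalue (hpos : ∀ x y, 0 < W x y) (hsum : ∀ x, ∑ y, W x y = 1) {z : ℂ}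
    (hz : 1 ≤ ‖z‖) (hev : Module.End.HasEigenvalue (W.map Complex.ofReal).toLin' z) : z = 1 := by
  obtain ⟨u, hu⟩ := hev.exists_hasEigenvector
  obtain ⟨x, hx⟩ := Function.ne_iff.1 hu.2
  have hconst : u = fun _ => u x :=
    funext fun y => eq_of_toLin'_eq_smul hpos hsum hz hu.apply_eq_smul y x
  have hfix : z • u = u := by
    rw [← hu.apply_eq_smul, hconst, toLin'_map_ofReal_const hsum]
  exact mul_eq_right₀ hx |>.1 (congrFun hfix x)

theorem eq_of_pow_sub_one_apply_eq_zero (hpos : ∀ x y, 0 < W x y) (hsum : ∀ x, ∑ y, W x y = 1)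
    {k : ℕ} {v : Ω → ℂ} (hv : (((W.map Complex.ofReal).toLin' - 1) ^ k) v = 0) (x y : Ω) :
    v x = v y := by
  induction k generalizing v x y with
  | zero => exact congrFun hv x |>.trans (congrFun hv y).symm
  | succ k ih =>
    rw [pow_succ, Module.End.mul_apply] at hv
    have hdrift : ∀ w, (W.map Complex.ofReal).toLin' v w =
        v w + ((W.map Complex.ofReal).toLin' - 1) v x := fun w => by
      rw [ih hv x w, LinearMap.sub_apply, Pi.sub_apply, Module.End.one_apply, add_sub_cancel]
    have : Nonempty Ω := ⟨x⟩
    have hdrift_zero : ((W.map Complex.ofReal).toLin' - 1) v x = 0 :=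
      eq_zero_of_sum_smul_eq_add_const (fun w z => (hpos w z).le) hsum
        fun w => (toLin'_map_ofReal_apply W v w).symm.trans (hdrift w)
    refine eq_of_toLin'_eq_smul hpos hsum norm_one.ge (funext fun w => ?_) x y
    rw [hdrift, hdrift_zero, add_zero, one_smul]

theorem maxGenEigenspace_one_le_span (hpos : ∀ x y, 0 < W x y) (hsum : ∀ x, ∑ y, W x y = 1) :
    Module.End.maxGenEigenspace (W.map Complex.ofReal).toLin' 1 ≤ Submodule.span ℂ {1} := by
  intro v hv
  obtain ⟨k, hk⟩ := (Module.End.mem_maxGenEigenspace _ 1 v).1 hv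
  rw [one_smul] at hk
  rw [Submodule.mem_span_singleton]
  rcases isEmpty_or_nonempty Ω with _ | ⟨⟨x⟩⟩
  · exact ⟨0, Subsingleton.elim _ _⟩
  · exact ⟨v x, funext fun y => by simp [eq_of_pow_sub_one_apply_eq_zero hpos hsum hk x y]⟩

theorem rootMultiplicity_charpoly_one_le (hpos : ∀ x y, 0 < W x y)
    (hsum : ∀ x, ∑ y, W x y = 1) :
    (W.map Complex.ofReal).charpoly.rootMultiplicity 1 ≤ 1 := by
  rw [← Matrix.charpoly_toLin', ← LinearMap.finrank_maxGenEigenspace_eq]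
  exact (Submodule.finrank_mono (maxGenEigenspace_one_le_span hpos hsum)).trans
    ((finrank_span_le_card {1}).trans (by simp))

theorem card_filter_one_le_norm_roots_charpoly_le (hpos : ∀ x y, 0 < W x y)
    (hsum : ∀ x, ∑ y, W x y = 1) :
    ((W.map Complex.ofReal).charpoly.roots.filter fun z => 1 ≤ ‖z‖).card ≤ 1 := by
  set χ := (W.map Complex.ofReal).charpoly
  have heq_one : ∀ z ∈ χ.roots.filter fun z => 1 ≤ ‖z‖, z = 1 := by
    intro z hz
    rw [Multiset.mem_filter] at hz
    refine eq_one_of_hasEigenvalue hpos hsum hz.2 ?_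
    rw [Module.End.hasEigenvalue_iff_isRoot_charpoly, Matrix.charpoly_toLin']
    exact Polynomial.isRoot_of_mem_roots hz.1
  calc (χ.roots.filter fun z => 1 ≤ ‖z‖).card
      = (χ.roots.filter fun z => 1 ≤ ‖z‖).count 1 :=
        (Multiset.count_eq_card.2 fun z hz => (heq_one z hz).symm).symm
    _ ≤ χ.roots.count 1 := Multiset.count_le_of_le _ (Multiset.filter_le _ _)
    _ = χ.rootMultiplicity 1 := Polynomial.count_roots χ
    _ ≤ 1 := rootMultiplicity_charpoly_one_le hpos hsum

theorem spectralGap_pos (hpos : ∀ x y, 0 < W x y) (hsum : ∀ x, ∑ y, W x y = 1) :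
    0 < spectralGap W := by
  refine sub_pos.2 (getD_sort_lt one_pos ?_)
  rw [Multiset.filter_map, Multiset.card_map]
  exact card_filter_one_le_norm_roots_charpoly_le hpos hsum

theorem spectralGap_le_one (W : Matrix Ω Ω ℝ) : spectralGap W ≤ 1 := by
  refine sub_le_self _ ?_
  rcases lt_or_ge 1 (eigenvalueModuli W).length with h | h
  · have hmem : (eigenvalueModuli W)[1] ∈ eigenvalueModuli W := List.getElem_mem h
    rw [List.getD_eq_getElem _ _ h]
    obtain ⟨z, -, hz⟩ := Multiset.mem_map.1 ((Multiset.mem_sort _).1 hmem)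
    exact hz ▸ norm_nonneg z
  · rw [List.getD_eq_default _ _ h]

end PositiveStochastic

section Reversible

/-- Detailed balance: the weights `p` and the matrix `W` satisfy `p x * W x y = p y * W y x`. It
makes `p` invariant under `W` as soon as the rows of `W` sum to one. -/
def IsReversible {ι R : Type*} [Mul R] (W : Matrix ι ι R) (p : ι → R) : Prop :=
  ∀ x y, p x * W x y = p y * W y x

theorem IsReversible.vecMul_eq_self {R : Type*} [CommSemiring R] {W : Matrix Ω Ω R} {p : Ω → R}
    (h : IsReversible W p) (hsum : ∀ x, ∑ y, W x y = 1) : Matrix.vecMul p W = p := by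
  funext x
  calc ∑ y, p y * W y x = ∑ y, p x * W x y := Finset.sum_congr rfl fun y _ => h y x
    _ = p x := by rw [← Finset.mul_sum, hsum, mul_one]

theorem IsReversible.mulVec_div_eq_self {K : Type*} [Field K] {W : Matrix Ω Ω K} {P p : Ω → K}
    (h : IsReversible W P) (hP : ∀ x, P x ≠ 0) (hp : Matrix.vecMul p W = p) :
    Matrix.mulVec W (p / P) = p / P := by
  funext x
  calc ∑ y, W x y * (p y / P y) = ∑ y, p y * W y x / P x := by
        refine Finset.sum_congr rfl fun y _ => ?_
        have hx := hP x
        have hy := hP y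
        field_simp
        linear_combination p y * h x y
    _ = p x / P x := by rw [← Finset.sum_div]; exact congrArg (· / P x) (congrFun hp x)

theorem IsReversible.isStationary_iff_eq {W : Matrix Ω Ω ℝ} {P : Ω → ℝ} (h : IsReversible W P)
    (hpos : ∀ x y, 0 < W x y) (hsum : ∀ x, ∑ y, W x y = 1) (hP : ∀ x, 0 < P x)
    (hPsum : ∑ x, P x = 1) (p : Ω → ℝ) : IsStationary W p ↔ p = P := by
  constructor
  · rintro ⟨⟨-, hpsum⟩, hp⟩
    have hharmonic := h.mulVec_div_eq_self (fun x => (hP x).ne') hp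
    have hdensity : ∀ x y, p x / P x = p y / P y :=
      eq_of_norm_le_norm_sum_smul hpos hsum fun x => (congrArg norm (congrFun hharmonic x)).ge
    funext x
    calc p x = ∑ y, p x * P y := by rw [← Finset.mul_sum, hPsum, mul_one]
      _ = ∑ y, p y * P x := Finset.sum_congr rfl fun y _ =>
          (div_eq_div_iff (hP x).ne' (hP y).ne').1 (hdensity x y)
      _ = P x := by rw [← Finset.sum_mul, hpsum, one_mul]
  · rintro rfl
    exact ⟨⟨fun x => (hP x).le, hPsum⟩, h.vecMul_eq_self hsum⟩

end Reversible

section Transition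

theorem accept_pos {ι : Type*} {P : ι → ℝ} {T : Matrix ι ι ℝ} (hP : ∀ x, 0 < P x)
    (hT : ∀ x y, 0 < T x y) (x y : ι) : 0 < accept P T x y :=
  lt_min one_pos (div_pos (mul_pos (hP y) (hT y x)) (mul_pos (hP x) (hT x y)))

theorem accept_le_one {ι : Type*} (P : ι → ℝ) (T : Matrix ι ι ℝ) (x y : ι) : accept P T x y ≤ 1 :=
  min_le_left _ _

theorem mul_accept {ι : Type*} {P : ι → ℝ} {T : Matrix ι ι ℝ} {x y : ι} (h : 0 < P x * T x y) :
    P x * (T x y * accept P T x y) = min (P x * T x y) (P y * T y x) := by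
  rw [accept, ← mul_assoc, mul_min_of_nonneg _ _ h.le, mul_one, mul_div_cancel₀ _ h.ne']

variable [DecidableEq Ω] {P : Ω → ℝ} {T : Matrix Ω Ω ℝ}

theorem isReversible_transition (hP : ∀ x, 0 < P x) (hT : ∀ x y, 0 < T x y) :
    IsReversible (transition P T) P := by
  intro x y
  rcases eq_or_ne x y with rfl | h
  · rfl
  · rw [transition, transition, if_neg h, if_neg h.symm, mul_accept (mul_pos (hP x) (hT x y)),
      mul_accept (mul_pos (hP y) (hT y x)), min_comm]

theorem transition_pos (hP : ∀ x, 0 < P x) (hT : ∀ x y, 0 < T x y) (hTsum : ∀ x, ∑ y, T x y = 1)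
    (x y : Ω) : 0 < transition P T x y := by
  rw [transition]
  split_ifs with h
  · refine sub_pos.2 ?_
    calc ∑ z ∈ Finset.univ.erase x, T x z * accept P T x z
        ≤ ∑ z ∈ Finset.univ.erase x, T x z :=
          Finset.sum_le_sum fun z _ => mul_le_of_le_one_right (hT x z).le (accept_le_one P T x z)
      _ < T x x + ∑ z ∈ Finset.univ.erase x, T x z := lt_add_of_pos_left _ (hT x x)
      _ = 1 := by rw [Finset.add_sum_erase _ _ (Finset.mem_univ x), hTsum]
  · exact mul_pos (hT x y) (accept_pos hP hT x y)

theorem sum_transition (P : Ω → ℝ) (T : Matrix Ω Ω ℝ) (x : Ω) : ∑ y, transition P T x y = 1 := by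
  have hoff : ∑ y ∈ Finset.univ.erase x, transition P T x y =
      ∑ y ∈ Finset.univ.erase x, T x y * accept P T x y :=
    Finset.sum_congr rfl fun y hy => if_neg (Finset.ne_of_mem_erase hy).symm
  rw [← Finset.add_sum_erase _ _ (Finset.mem_univ x), hoff, transition, if_pos rfl, sub_add_cancel]

theorem isStationary_transition_iff_eq (hP : ∀ x, 0 < P x) (hPsum : ∑ x, P x = 1)
    (hT : ∀ x y, 0 < T x y) (hTsum : ∀ x, ∑ y, T x y = 1) (p : Ω → ℝ) :
    IsStationary (transition P T) p ↔ p = P :=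
  (isReversible_transition hP hT).isStationary_iff_eq (transition_pos hP hT hTsum)
    (sum_transition P T) hP hPsum p

end Transition

section TotalVariation

theorem tvDist_le_of_one_sub_mul_le {p q : Ω → ℝ} {δ : ℝ} (hp : p ∈ stdSimplex ℝ Ω)
    (hq : q ∈ stdSimplex ℝ Ω) (h : ∀ x, (1 - δ) * p x ≤ q x) : tvDist p q ≤ δ := by
  classical
  have hsum : ∀ A : Finset Ω, (1 - δ) * ∑ x ∈ A, p x ≤ ∑ x ∈ A, q x := fun A => by
    rw [Finset.mul_sum]
    exact Finset.sum_le_sum fun x _ => h x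
  have hδ : 0 ≤ δ := by
    have hunivsum := hsum Finset.univ
    rw [hp.2, hq.2] at hunivsum
    linarith
  have hle : ∀ A : Finset Ω, ∑ x ∈ A, p x - ∑ x ∈ A, q x ≤ δ := fun A => by
    have hmass : ∑ x ∈ A, p x ≤ 1 := hp.2 ▸ Finset.sum_le_univ_sum_of_nonneg hp.1
    linarith [hsum A, mul_le_of_le_one_right hδ hmass]
  refine ciSup_le fun A => abs_sub_le_iff.2 ⟨hle A, ?_⟩
  have hpA := Finset.sum_add_sum_compl A p
  have hqA := Finset.sum_add_sum_compl A q
  rw [hp.2] at hpA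
  rw [hq.2] at hqA
  linarith [hle Aᶜ]

end TotalVariation

section Target

variable {P₀ : Ω → ℝ}

theorem partitionFunction_pos [Nonempty Ω] (hP₀ : ∀ x, 0 < P₀ x) (L : Ω → ℝ) :
    0 < ∑ y, P₀ y * Real.exp (-L y) :=
  Finset.sum_pos (fun y _ => mul_pos (hP₀ y) (Real.exp_pos _)) Finset.univ_nonempty

theorem target_pos (hP₀ : ∀ x, 0 < P₀ x) (L : Ω → ℝ) (x : Ω) : 0 < target P₀ L x :=
  have : Nonempty Ω := ⟨x⟩
  div_pos (mul_pos (hP₀ x) (Real.exp_pos _)) (partitionFunction_pos hP₀ L)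

theorem sum_target [Nonempty Ω] (hP₀ : ∀ x, 0 < P₀ x) (L : Ω → ℝ) : ∑ x, target P₀ L x = 1 := by
  simp only [target]
  rw [← Finset.sum_div, div_self (partitionFunction_pos hP₀ L).ne']

theorem target_mem_stdSimplex [Nonempty Ω] (hP₀ : ∀ x, 0 < P₀ x) (L : Ω → ℝ) :
    target P₀ L ∈ stdSimplex ℝ Ω :=
  ⟨fun x => (target_pos hP₀ L x).le, sum_target hP₀ L⟩

theorem exp_neg_mul_mul_exp_neg_le {w a b ε : ℝ} (hw : 0 ≤ w) (h : b - a ≤ ε) :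
    Real.exp (-ε) * (w * Real.exp (-a)) ≤ w * Real.exp (-b) := by
  rw [mul_left_comm, ← Real.exp_add]
  exact mul_le_mul_of_nonneg_left (Real.exp_le_exp.2 (by linarith)) hw

theorem exp_neg_mul_target_le (hP₀ : ∀ x, 0 < P₀ x) {L L' : Ω → ℝ} {ε : ℝ}
    (h : ∀ x, |L' x - L x| ≤ ε) (x : Ω) :
    Real.exp (-(2 * ε)) * target P₀ L' x ≤ target P₀ L x := by
  have : Nonempty Ω := ⟨x⟩
  have hweight : Real.exp (-ε) * (P₀ x * Real.exp (-L' x)) ≤ P₀ x * Real.exp (-L x) :=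
    exp_neg_mul_mul_exp_neg_le (hP₀ x).le (by linarith [(abs_le.1 (h x)).1])
  have hpartitionFunction :
      Real.exp (-ε) * ∑ y, P₀ y * Real.exp (-L y) ≤ ∑ y, P₀ y * Real.exp (-L' y) := by
    rw [Finset.mul_sum]
    exact Finset.sum_le_sum fun y _ =>
      exp_neg_mul_mul_exp_neg_le (hP₀ y).le (abs_le.1 (h y)).2
  rw [target, target, ← mul_div_assoc,
    div_le_div_iff₀ (partitionFunction_pos hP₀ L') (partitionFunction_pos hP₀ L)]
  calc Real.exp (-(2 * ε)) * (P₀ x * Real.exp (-L' x)) * ∑ y, P₀ y * Real.exp (-L y)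
      = (Real.exp (-ε) * (P₀ x * Real.exp (-L' x))) *
          (Real.exp (-ε) * ∑ y, P₀ y * Real.exp (-L y)) := by
        rw [two_mul, neg_add, Real.exp_add]
        ring
    _ ≤ _ := mul_le_mul hweight hpartitionFunction
        (mul_nonneg (Real.exp_pos _).le (partitionFunction_pos hP₀ L).le)
        (mul_pos (hP₀ x) (Real.exp_pos _)).le

theorem tvDist_target_le [Nonempty Ω] (hP₀ : ∀ x, 0 < P₀ x) (L L' : Ω → ℝ) :
    tvDist (target P₀ L') (target P₀ L) ≤ 2 * ⨆ x, |L' x - L x| := by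
  set ε := ⨆ x, |L' x - L x|
  have hε : ∀ x, |L' x - L x| ≤ ε := le_ciSup (Set.finite_range fun x => |L' x - L x|).bddAbove
  refine tvDist_le_of_one_sub_mul_le (target_mem_stdSimplex hP₀ L') (target_mem_stdSimplex hP₀ L)
    fun x => ?_
  calc (1 - 2 * ε) * target P₀ L' x ≤ Real.exp (-(2 * ε)) * target P₀ L' x :=
        mul_le_mul_of_nonneg_right (Real.one_sub_le_exp_neg _) (target_pos hP₀ L' x).le
    _ ≤ target P₀ L x := exp_neg_mul_target_le hP₀ hε x

end Target

section MixingFactor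

theorem nontrivial_of_sum_eq_one_of_lt_one {p : Ω → ℝ} (hsum : ∑ x, p x = 1) (hp : ∀ x, p x < 1) :
    Nontrivial Ω := by
  by_contra hΩ
  rw [not_nontrivial_iff_subsingleton] at hΩ
  obtain ⟨x, -⟩ := Finset.nonempty_of_sum_ne_zero (hsum.trans_ne one_ne_zero)
  rw [Fintype.sum_subsingleton _ x] at hsum
  exact (hp x).ne hsum

theorem iInf_le_inv_card [Nonempty Ω] {p : Ω → ℝ} (hsum : ∑ x, p x = 1) :
    ⨅ x, p x ≤ (Fintype.card Ω : ℝ)⁻¹ := by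
  have hle := Finset.card_nsmul_le_sum Finset.univ p _ fun x _ =>
    ciInf_le (Set.finite_range p).bddBelow x
  rw [hsum, nsmul_eq_mul, Finset.card_univ] at hle
  rwa [← mul_one (_)⁻¹, le_inv_mul_iff₀ (Nat.cast_pos.2 Fintype.card_pos)]

theorem iInf_pos {ι : Type*} [Finite ι] [Nonempty ι] {p : ι → ℝ} (hp : ∀ x, 0 < p x) :
    0 < ⨅ x, p x := by
  obtain ⟨x, hx⟩ := exists_eq_ciInf_of_finite (f := p)
  exact hx ▸ hp x

theorem neg_div_le_div_log_one_sub {t c Δ : ℝ} (hc : 0 ≤ c) (ht : t ≤ c) (hΔ : 0 < Δ)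
    (hΔ' : Δ ≤ 1) : -(c / Δ) ≤ t / Real.log (1 - Δ) := by
  rcases hΔ'.eq_or_lt with rfl | hlt
  · -- Here `log 0 = 0`, so the quotient on the right is `0`.
    simpa using hc
  have hlog : Real.log (1 - Δ) ≤ -Δ := by
    linarith [Real.log_le_sub_one_of_pos (sub_pos.2 hlt)]
  rw [le_div_iff_of_neg (by linarith)]
  calc t ≤ c / Δ * Δ := by rwa [div_mul_cancel₀ _ hΔ.ne']
    _ ≤ c / Δ * -Real.log (1 - Δ) :=
        mul_le_mul_of_nonneg_left (by linarith) (div_nonneg hc hΔ.le)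
    _ = -(c / Δ) * Real.log (1 - Δ) := by ring

theorem half_le_ceil_log_div_log_add_inv {m Δ : ℝ} (hm : 0 < m) (hm' : m ≤ 1 / 2)
    (hΔ : 0 < Δ) (hΔ' : Δ ≤ 1) :
    1 / 2 ≤ ((⌈Real.log (2 * √m) / Real.log (1 - Δ)⌉ : ℤ) : ℝ) + 1 / Δ := by
  have hinv : 1 ≤ 1 / Δ := (one_le_div hΔ).2 hΔ'
  have hsqrt : √m ≤ 3 / 4 := Real.sqrt_le_iff.2 ⟨by norm_num, by linarith⟩
  have hlog : Real.log (2 * √m) ≤ 1 / 2 := by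
    linarith [Real.log_le_sub_one_of_pos (mul_pos two_pos (Real.sqrt_pos.2 hm))]
  have hquot := neg_div_le_div_log_one_sub one_half_pos.le hlog hΔ hΔ'
  rw [div_right_comm] at hquot
  linarith [Int.le_ceil (Real.log (2 * √m) / Real.log (1 - Δ))]

end MixingFactor

end MetropolisHastings

theorem mainTheorem6_general {Ω : Type*} [Fintype Ω] [DecidableEq Ω] [Nontrivial Ω]
    {P₀ : Ω → ℝ} (hP₀ : ∀ x, 0 < P₀ x)
    {T : Matrix Ω Ω ℝ} (hT : ∀ x y, 0 < T x y) (hTsum : ∀ x, ∑ y, T x y = 1) (L L' : Ω → ℝ)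
    {P P' : Ω → ℝ} (hP : P = MetropolisHastings.target P₀ L)
    (hP' : P' = MetropolisHastings.target P₀ L')
    {W W' : Matrix Ω Ω ℝ} (hW : W = MetropolisHastings.transition P T)
    (hW' : W' = MetropolisHastings.transition P' T)
    {Δ : ℝ} (hΔ : Δ = MetropolisHastings.spectralGap W) :
    (∀ p : Ω → ℝ, MetropolisHastings.IsStationary W p ↔ p = P) ∧
    (∀ p : Ω → ℝ, MetropolisHastings.IsStationary W' p ↔ p = P') ∧
    (0 < Δ ∧ Δ ≤ 1) ∧
    MetropolisHastings.tvDist P' P ≤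
      8 * (((⌈Real.log (2 * √(⨅ x, P x)) / Real.log (1 - Δ)⌉ : ℤ) : ℝ) + 1 / Δ) *
        ⨆ x, |L' x - L x| := by
  open MetropolisHastings in
  subst hP hP' hW hW' hΔ
  have hpos := target_pos hP₀ L
  have hgap : 0 < spectralGap (transition (target P₀ L) T) :=
    spectralGap_pos (transition_pos hpos hT hTsum) (sum_transition _ T)
  have hgap' := spectralGap_le_one (transition (target P₀ L) T)
  have hmin : ⨅ x, target P₀ L x ≤ 1 / 2 := by
    refine (iInf_le_inv_card (sum_target hP₀ L)).trans ?_
    rw [one_div]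
    exact inv_anti₀ two_pos (mod_cast Fintype.one_lt_card)
  refine ⟨isStationary_transition_iff_eq hpos (sum_target hP₀ L) hT hTsum,
    isStationary_transition_iff_eq (target_pos hP₀ L') (sum_target hP₀ L') hT hTsum,
    ⟨hgap, hgap'⟩, (tvDist_target_le hP₀ L L').trans ?_⟩
  refine mul_le_mul_of_nonneg_right ?_ (Real.iSup_nonneg fun x => abs_nonneg _)
  linarith [half_le_ceil_log_div_log_add_inv (iInf_pos hpos) hmin hgap hgap']

theorem mainTheorem6 {Ω : Type*} [Fintype Ω] [DecidableEq Ω]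
    (P₀ : Ω → ℝ) (hP₀pos : ∀ x, 0 < P₀ x) (hP₀sum : ∑ x, P₀ x = 1)
    (T : Matrix Ω Ω ℝ) (hT : ∀ x y, T x y ∈ Set.Ioo (0 : ℝ) 1) (hTsum : ∀ x, ∑ y, T x y = 1)
    (L L' : Ω → ℝ) (hL : ∀ x, 0 < L x) (hL' : ∀ x, 0 < L' x)
    (P P' : Ω → ℝ) (hP : P = MetropolisHastings.target P₀ L)
    (hP' : P' = MetropolisHastings.target P₀ L')
    (W W' : Matrix Ω Ω ℝ) (hW : W = MetropolisHastings.transition P T)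
    (hW' : W' = MetropolisHastings.transition P' T)
    (Δ : ℝ) (hΔ : Δ = MetropolisHastings.spectralGap W) :
    (∀ p : Ω → ℝ, MetropolisHastings.IsStationary W p ↔ p = P) ∧
    (∀ p : Ω → ℝ, MetropolisHastings.IsStationary W' p ↔ p = P') ∧
    (0 < Δ ∧ Δ ≤ 1) ∧
    MetropolisHastings.tvDist P' P ≤
      8 * (((⌈Real.log (2 * √(⨅ x, P x)) / Real.log (1 - Δ)⌉ : ℤ) : ℝ) + 1 / Δ) *
        ⨆ x, |L' x - L x| := by
  obtain ⟨x, -⟩ := Finset.nonempty_of_sum_ne_zero (hP₀sum.trans_ne one_ne_zero)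
  have := MetropolisHastings.nontrivial_of_sum_eq_one_of_lt_one (hTsum x) fun y => (hT x y).2
  exact mainTheorem6_general hP₀pos (fun x y => (hT x y).1) hTsum L L' hP hP' hW hW' hΔ
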